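/- Let $F$ be a field of characteristic zero. An algebra with trace is a unital associative $F$-algebra $A$ with an $F$-linear map $\mathrm{tr}\colon A\to F$ such that $\mathrm{tr}(ab)=\mathrm{tr}(ba)$ for all $a,b\in A$. Let $F\langle X,\mathrm{Tr}\rangle=F\langle X\rangle\otimes_F F[\mathrm{Tr}(M)]$ be the free algebra with trace on a countable set $X$, where $M$ runs over the nonempty monomials in $X$ and $\mathrm{Tr}(MN)=\mathrm{Tr}(NM)$. Let $\mathrm{Id}^{tr}(A)\subseteq F\langle X,\mathrm{Tr}\rangle$ be the set of trace identities of $A$, i.e. of the trace polynomials that vanish whenever the variables are replaced by elements of $A$ and $\mathrm{Tr}$ by $\mathrm{tr}$. Write $A\sim_{T^{tr}}B$ if $\mathrm{Id}^{tr}(A)=\mathrm{Id}^{tr}(B)$, and let $\mathrm{var}^{tr}(A)$ be the class of all algebras with trace that satisfy every trace identity of $A$. For $\alpha\in F$ let $D_2^{t_{\alpha,\alpha}}$ be the algebra of diagonal $2\times2$ matrices over $F$ with trace $\mathrm{diag}(a,b)\mapsto\alpha a+\alpha b$. For $k\ge1$ let $C_k^{t_{\alpha,0}}$ be the algebra of upper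 triangular $k\times k$ matrices over $F$ that are constant along the main diagonal and along each diagonal above it, with trace $c\mapsto\alpha c_{11}$. Let $A$ be a nonzero unital finite dimensional algebra with trace over $F$, and let $\alpha\in F$, $\alpha\neq0$. If $\mathrm{var}^{tr}(A)\subsetneq\mathrm{var}^{tr}(D_2^{t_{\alpha,\alpha}})$, then either $A\sim_{T^{tr}}C_1^{t_{\beta,0}}$ for some $\beta\in\{0,\alpha,2\alpha\}$, or $A\sim_{T^{tr}}C_2^{t_{2\alpha,0}}$. -/

import Mathlib

open scoped TensorProduct

universe u v w

/-- An `F`-valued trace on a unital associative `F`-algebra `A`. -/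
structure AlgebraTrace (F : Type u) (A : Type v) [Field F] [Ring A] [Algebra F A] where
  /-- the underlying linear functional -/
  toFun : A →ₗ[F] F
  mul_comm' : ∀ a b : A, toFun (a * b) = toFun (b * a)

/-- The formal trace variables `Tr(M)`: one for every nonempty monomial `M` in the free generators
`x_0, x_1, …`, where `Tr(MN)` and `Tr(NM)` are the same variable. -/
abbrev TraceWord : Type := {c : Cycle ℕ // c ≠ Cycle.nil}

/-- The free algebra with trace `F⟨X, Tr⟩ = F⟨X⟩ ⊗ F[Tr(M)]` on countably many generators. -/
abbrev FreeTraceAlgebra (F : Type u) [Field F] : Type u :=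
  FreeAlgebra F ℕ ⊗[F] MvPolynomial TraceWord F

namespace AlgebraTrace

variable {F : Type u} {A : Type v} [Field F] [Ring A] [Algebra F A]

/-- The value `tr(a_{i_1} ⋯ a_{i_m})` of the trace on the cyclic word `(i_1, …, i_m)`. -/
def cyclicWord (t : AlgebraTrace F A) (a : ℕ → A) (c : Cycle ℕ) : F :=
  Quotient.liftOn c (fun l : List ℕ => t.toFun (l.map a).prod) (by
    rintro l _ ⟨n, rfl⟩
    induction n generalizing l with
    | zero => simp
    | succ n ih =>
      cases l with
      | nil => simp
      | cons x l =>
        rw [List.rotate_cons_succ, ← ih]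
        simp [t.mul_comm'])

/-- Evaluation of trace polynomials: `x_i ↦ a_i` and `Tr ↦ tr`. -/
noncomputable def eval (t : AlgebraTrace F A) (a : ℕ → A) : FreeTraceAlgebra F →ₐ[F] A :=
  Algebra.TensorProduct.lift (FreeAlgebra.lift F a)
    ((Algebra.ofId F A).comp (MvPolynomial.aeval fun c : TraceWord => t.cyclicWord a c.1))
    (fun _ _ => by
      rw [AlgHom.comp_apply, Algebra.ofId_apply]
      exact Algebra.commute_algebraMap_right _ _)

/-- The set `Id^tr(A)` of trace identities of `A`. -/
def identities (t : AlgebraTrace F A) : Set (FreeTraceAlgebra F) :=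
  {f | ∀ a : ℕ → A, t.eval a f = 0}

/-- `T^tr`-equivalence of two algebras with trace: they have the same trace identities. -/
def Equivalent {B : Type w} [Ring B] [Algebra F B] (t : AlgebraTrace F A) (s : AlgebraTrace F B) :
    Prop :=
  t.identities = s.identities

end AlgebraTrace

/-- Bundled unital `F`-algebras with trace, with underlying type in `Type w`. -/
structure TraceAlg (F : Type u) [Field F] where
  carrier : Type w
  [ring : Ring carrier]
  [algebra : Algebra F carrier]
  trace : AlgebraTrace F carrier

attribute [instance] TraceAlg.ring TraceAlg.algebra

/-- The variety `var^tr(A)` generated by an algebra with trace `A`: the class of all algebras with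
trace (with underlying type in `Type w`) which satisfy every trace identity of `A`. -/
def AlgebraTrace.variety {F : Type u} {A : Type v} [Field F] [Ring A] [Algebra F A]
    (t : AlgebraTrace F A) : Set (TraceAlg.{u, w} F) :=
  {B | ∀ f ∈ t.identities, f ∈ B.trace.identities}

/-- The algebra `D_n` of diagonal `n × n` matrices. -/
def diagonalMatrices (F : Type u) [Field F] (n : ℕ) : Subalgebra F (Matrix (Fin n) (Fin n) F) where
  carrier := {M | M.IsDiag}
  mul_mem' := by
    intro M N hM hN i j hij
    rw [Matrix.mul_apply]
    refine Finset.sum_eq_zero fun l _ => ?_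
    by_cases h : i = l
    · subst h; rw [hN hij, mul_zero]
    · rw [hM h, zero_mul]
  add_mem' := fun hM hN => Matrix.IsDiag.add hM hN
  algebraMap_mem' := by
    intro r i j hij
    simp [Matrix.algebraMap_matrix_apply, hij]

/-- The trace `t_{α_1, …, α_n}(a) = α_1 a_{11} + ⋯ + α_n a_{nn}` on `D_n`. -/
def diagonalTrace {F : Type u} [Field F] {n : ℕ} (α : Fin n → F) :
    AlgebraTrace F (diagonalMatrices F n) where
  toFun :=
    { toFun := fun M => ∑ i, α i * M.1 i i
      map_add' := by
        intro M N
        simp [mul_add, Finset.sum_add_distrib]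
      map_smul' := by
        intro r M
        simp [Finset.mul_sum, mul_left_comm] }
  mul_comm' := by
    intro M N
    have key : ∀ (M N : diagonalMatrices F n) (i : Fin n),
        (M.1 * N.1) i i = M.1 i i * N.1 i i := by
      intro M N i
      rw [Matrix.mul_apply]
      refine Finset.sum_eq_single i (fun l _ hl => ?_) (by simp)
      rw [M.2 (Ne.symm hl), zero_mul]
    simp only [LinearMap.coe_mk, AddHom.coe_mk, MulMemClass.coe_mul, key]
    exact Finset.sum_congr rfl fun i _ => by rw [mul_comm (M.1 i i)]

/-- The algebra `C_k` of upper triangular `k × k` matrices which are constant along the main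
diagonal and along each diagonal above it (`c m` is the entry on the `m`-th diagonal). -/
def toeplitzMatrices (F : Type u) [Field F] (k : ℕ) : Subalgebra F (Matrix (Fin k) (Fin k) F) where
  carrier := {M | ∃ c : ℕ → F, ∀ i j : Fin k,
    M i j = if i ≤ j then c ((j : ℕ) - (i : ℕ)) else 0}
  mul_mem' := by
    rintro M N ⟨c, hc⟩ ⟨d, hd⟩
    refine ⟨fun m => ∑ s ∈ Finset.range (m + 1), c s * d (m - s), fun i j => ?_⟩
    rw [Matrix.mul_apply]
    simp only [hc, hd]
    split_ifs with hij
    · have hij' : (i : ℕ) ≤ j := hij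
      symm
      refine Finset.sum_bij_ne_zero
        (fun s hs _ => (⟨i + s, by have := Finset.mem_range.1 hs; omega⟩ : Fin k))
        (fun _ _ _ => Finset.mem_univ _) ?_ ?_ ?_
      · intro a _ _ b _ _ h
        simpa using h
      · intro l _ hl
        have h1 : i ≤ l := by by_contra h; simp [h] at hl
        have h2 : l ≤ j := by by_contra h; simp [h] at hl
        rw [if_pos h1, if_pos h2] at hl
        have h1' : (i : ℕ) ≤ l := h1
        have h2' : (l : ℕ) ≤ j := h2
        refine ⟨l - i, Finset.mem_range.2 (by omega), ?_, ?_⟩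
        · have : (j : ℕ) - i - (l - i) = j - l := by omega
          rwa [this]
        · ext; simp; omega
      · intro s hs _
        have hs' := Finset.mem_range.1 hs
        rw [if_pos (Fin.le_def.2 (by simp)), if_pos (Fin.le_def.2 (by simp; omega))]
        congr 2
        · simp
        · simp; omega
    · refine Finset.sum_eq_zero fun l _ => ?_
      by_cases h1 : i ≤ l
      · rw [if_neg (fun h2 => hij (h1.trans h2)), mul_zero]
      · rw [if_neg h1, zero_mul]
  add_mem' := by
    rintro M N ⟨c, hc⟩ ⟨d, hd⟩
    refine ⟨c + d, fun i j => ?_⟩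
    rw [Matrix.add_apply, hc, hd]
    split_ifs <;> simp
  algebraMap_mem' := by
    intro r
    refine ⟨fun m => if m = 0 then r else 0, fun i j => ?_⟩
    rw [Matrix.algebraMap_matrix_apply]
    simp only [Fin.ext_iff, Fin.le_def, Algebra.algebraMap_self, RingHom.id_apply]
    split_ifs <;> first | rfl | omega

/-- The trace `t_{α, 0}` on `C_k`, `k ≥ 1`: it multiplies by `α` the entry on the main diagonal and
vanishes on the strictly upper triangular matrices of `C_k`. -/
def toeplitzTrace {F : Type u} [Field F] (k : ℕ) [NeZero k] (α : F) :
    AlgebraTrace F (toeplitzMatrices F k) where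
  toFun :=
    { toFun := fun M => α * M.1 0 0
      map_add' := by intro M N; simp [mul_add]
      map_smul' := by intro r M; simp [mul_left_comm] }
  mul_comm' := by
    have key : ∀ M N : toeplitzMatrices F k, (M.1 * N.1) 0 0 = M.1 0 0 * N.1 0 0 := by
      intro M N
      rw [Matrix.mul_apply]
      refine Finset.sum_eq_single 0 (fun l _ hl => ?_) (by simp)
      obtain ⟨d, hd⟩ := N.2
      rw [hd, if_neg (fun h => hl (le_antisymm h (Fin.zero_le l))), mul_zero]
    intro M N
    simp only [LinearMap.coe_mk, AddHom.coe_mk, MulMemClass.coe_mul, key]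
    rw [mul_comm (M.1 0 0)]

/-! The algebra `D_2` is commutative and satisfies a rescaled, polarized Cayley-Hamilton identity;
`A` inherits both (`mul_comm_of_diagonal_identities`, `cayleyHamilton_of_diagonal_identities`). Put
s = tr(1). Setting y = 1 gives (2α - s)(αx - tr(x)) = 0 for every x.

If s ≠ 2α, every element is a scalar and s = α, so A ~ C_1; the value β = 0 never occurs.

If s = 2α, let p = tr / (2α) and N = ker p. Then A = F ⊕ N, and the identity forces N·N ⊆ F. When
N·N = 0, A is equivalent to C_1 (N = 0) or C_2 (N ≠ 0). Otherwise some x in N has x² = d ≠ 0, and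
associativity gives N = Fx. Over a field containing √d such an algebra becomes `D_2`, and since F is
infinite its trace identities already hold in `D_2` (`identities_subset_diagonalTrace`). This
contradicts properness of the inclusion. -/

namespace AlgebraTrace

/-! ### Trace-preserving homomorphisms and varieties -/

section Transfer

variable {F : Type u} [Field F] {A : Type v} [Ring A] [Algebra F A] {B : Type w} [Ring B]
  [Algebra F B]

@[simp]
theorem eval_ι (t : AlgebraTrace F A) (a : ℕ → A) (i : ℕ) :
    t.eval a (FreeAlgebra.ι F i ⊗ₜ 1) = a i := by
  simp [eval]

@[simp]
theorem eval_X (t : AlgebraTrace F A) (a : ℕ → A) (c : TraceWord) :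
    t.eval a (1 ⊗ₜ MvPolynomial.X c) = algebraMap F A (t.cyclicWord a c.1) := by
  simp [eval, Algebra.ofId_apply]

theorem cyclicWord_coe (t : AlgebraTrace F A) (a : ℕ → A) (l : List ℕ) :
    t.cyclicWord a (l : Cycle ℕ) = t.toFun (l.map a).prod := rfl

/-- Homomorphisms from the free algebra with trace agree if they agree on generators. -/
theorem freeTraceAlgebra_hom_ext {φ ψ : FreeTraceAlgebra F →ₐ[F] B}
    (h₁ : ∀ i, φ (FreeAlgebra.ι F i ⊗ₜ 1) = ψ (FreeAlgebra.ι F i ⊗ₜ 1))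
    (h₂ : ∀ c : TraceWord, φ (1 ⊗ₜ MvPolynomial.X c) = ψ (1 ⊗ₜ MvPolynomial.X c)) : φ = ψ := by
  apply Algebra.TensorProduct.ext
  · apply FreeAlgebra.hom_ext
    funext i
    exact h₁ i
  · apply MvPolynomial.algHom_ext
    exact h₂

theorem map_eval {t : AlgebraTrace F A} {s : AlgebraTrace F B} (φ : A →ₐ[F] B)
    (h : ∀ a, s.toFun (φ a) = t.toFun a) (a : ℕ → A) (f : FreeTraceAlgebra F) :
    φ (t.eval a f) = s.eval (fun i => φ (a i)) f := by
  suffices H : φ.comp (t.eval a) = s.eval (fun i => φ (a i)) from DFunLike.congr_fun H f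
  apply freeTraceAlgebra_hom_ext
  · intro i
    simp
  · rintro ⟨c, hc⟩
    rw [AlgHom.comp_apply, eval_X, eval_X, AlgHom.commutes]
    congr 1
    induction c using Quotient.inductionOn with
    | _ l =>
      change t.toFun (l.map a).prod = s.toFun (l.map fun i => φ (a i)).prod
      rw [← h, map_list_prod, List.map_map]
      rfl

theorem identities_subset_of_injective {t : AlgebraTrace F A} {s : AlgebraTrace F B}
    (φ : A →ₐ[F] B) (h : ∀ a, s.toFun (φ a) = t.toFun a) (hφ : Function.Injective φ) :
    s.identities ⊆ t.identities := by
  intro f hf a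
  apply hφ
  rw [map_eval φ h, hf, map_zero]

theorem identities_subset_of_surjective {t : AlgebraTrace F A} {s : AlgebraTrace F B}
    (φ : A →ₐ[F] B) (h : ∀ a, s.toFun (φ a) = t.toFun a) (hφ : Function.Surjective φ) :
    t.identities ⊆ s.identities := by
  intro f hf b
  obtain ⟨a, rfl⟩ : ∃ a : ℕ → A, (fun i => φ (a i)) = b :=
    ⟨fun i => (hφ (b i)).choose, funext fun i => (hφ (b i)).choose_spec⟩
  rw [← map_eval φ h, hf, map_zero]

theorem equivalent_of_bijective {t : AlgebraTrace F A} {s : AlgebraTrace F B}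
    (φ : A →ₐ[F] B) (h : ∀ a, s.toFun (φ a) = t.toFun a) (hφ : Function.Bijective φ) :
    t.Equivalent s :=
  (identities_subset_of_surjective φ h hφ.2).antisymm
    (identities_subset_of_injective φ h hφ.1)

/-- The trace transported to a universe lift of the algebra. -/
def ulift (t : AlgebraTrace F A) : AlgebraTrace F (ULift.{w} A) where
  toFun := t.toFun.comp (ULift.algEquiv (R := F) (A := A)).toLinearMap
  mul_comm' a b := t.mul_comm' a.down b.down

theorem ulift_identities (t : AlgebraTrace F A) :
    (ulift.{u, v, w} t).identities = t.identities :=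
  equivalent_of_bijective (s := t) (t := ulift.{u, v, w} t)
    (ULift.algEquiv (R := F) (A := A)).toAlgHom (fun _ => rfl)
    (ULift.algEquiv (R := F) (A := A)).bijective

/-- `A` lies in its own variety once it is lifted to the common universe `max v w`. -/
theorem identities_subset_of_variety_subset {t : AlgebraTrace F A} {s : AlgebraTrace F B}
    (h : variety.{u, v, max v w} t ⊆ variety.{u, w, max v w} s) :
    s.identities ⊆ t.identities := by
  have hA : (⟨ULift.{w} A, ulift.{u, v, w} t⟩ : TraceAlg.{u, max v w} F) ∈ t.variety :=
    fun f hf => by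
      change f ∈ (ulift.{u, v, w} t).identities
      rwa [ulift_identities]
  intro f hf
  have : f ∈ (ulift.{u, v, w} t).identities := h hA f hf
  rwa [ulift_identities] at this

theorem not_identities_subset_of_variety_ssubset {t : AlgebraTrace F A} {s : AlgebraTrace F B}
    (h : variety.{u, v, max v w} t ⊂ variety.{u, w, max v w} s) :
    ¬ t.identities ⊆ s.identities :=
  fun hts => h.2 fun _ hC f hf => hC f (hts hf)

/-- If every element is a scalar, the algebra is equivalent to `C_1`. -/
theorem equivalent_toeplitzTrace_one [Nontrivial A] (t : AlgebraTrace F A) (β : F)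
    (hA : ∀ a : A, ∃ r : F, a = algebraMap F A r) (ht : t.toFun 1 = β) :
    t.Equivalent (toeplitzTrace 1 β) := by
  let τ : AlgebraTrace F F := ⟨β • LinearMap.id, fun a b => by simp [mul_comm]⟩
  have h₁ : τ.Equivalent t := by
    refine equivalent_of_bijective (Algebra.ofId F A) (fun r => ?_)
      ⟨(algebraMap F A).injective, fun a => ?_⟩
    · rw [Algebra.ofId_apply, Algebra.algebraMap_eq_smul_one, map_smul, ht]
      simp [τ, mul_comm]
    · obtain ⟨r, hr⟩ := hA a
      exact ⟨r, hr.symm⟩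
  have h₂ : τ.Equivalent (toeplitzTrace 1 β) := by
    refine equivalent_of_bijective (Algebra.ofId F (toeplitzMatrices F 1)) (fun r => ?_)
      ⟨(algebraMap F (toeplitzMatrices F 1)).injective, fun M => ⟨M.1 0 0, ?_⟩⟩
    · simp [τ, toeplitzTrace, Algebra.ofId_apply, Matrix.algebraMap_matrix_apply]
    · ext i j
      fin_cases i
      fin_cases j
      simp [Algebra.ofId_apply, Matrix.algebraMap_matrix_apply]
  exact h₁.symm.trans h₂

end Transfer

/-! ### Square-zero extensions of F and C_2 -/

section DualNumbers

variable {F : Type u} [Field F] {A : Type v} [Ring A] [Algebra F A]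

theorem toeplitz_two_lower (M : toeplitzMatrices F 2) : M.1 1 0 = 0 := by
  obtain ⟨c, hc⟩ := M.2
  simp [hc]

theorem toeplitz_two_diag (M : toeplitzMatrices F 2) : M.1 1 1 = M.1 0 0 := by
  obtain ⟨c, hc⟩ := M.2
  simp [hc]

/-- The element of `C_2` with diagonal entry `a` and upper entry `b`. -/
def toeplitzTwo (a b : F) : toeplitzMatrices F 2 :=
  ⟨!![a, b; 0, a], fun m => if m = 0 then a else b, fun i j => by
    fin_cases i <;> fin_cases j <;> simp⟩

/-- Suppose that `A = F ⊕ N` with `N ^ 2 = 0`, `N ≠ 0`, where `l` is the projection to `F`.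
If the trace factors through `l`, then `A` is equivalent to `C_2`. -/
theorem equivalent_toeplitzTrace_two (t : AlgebraTrace F A) (β : F) (l : A →ₗ[F] F)
    (hl : l 1 = 1) (ht : ∀ a, t.toFun a = β * l a)
    (hN : ∀ x y : A, l x = 0 → l y = 0 → x * y = 0) (x : A) (hx : l x = 0) (hx0 : x ≠ 0) :
    t.Equivalent (toeplitzTrace 2 β) := by
  have hmul : ∀ y z : A, y * z = l y • (z - l z • 1) + l z • (y - l y • 1) + (l y * l z) • 1 := by
    intro y z
    have := hN (y - l y • 1) (z - l z • 1) (by simp [hl]) (by simp [hl])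
    simp only [sub_mul, mul_sub, smul_mul_assoc, mul_smul_comm, one_mul, mul_one] at this
    rw [← sub_eq_zero, ← this]
    module
  have hlmul : ∀ y z : A, l (y * z) = l y * l z := by
    intro y z
    rw [hmul]
    simp [hl]
  apply Set.Subset.antisymm
  -- C_2 embeds in A as F ⊕ Fx.
  · let ψ : toeplitzMatrices F 2 →ₐ[F] A := AlgHom.ofLinearMap
      { toFun := fun M => M.1 0 0 • 1 + M.1 0 1 • x
        map_add' := fun M N => by simp [add_smul]; abel
        map_smul' := fun r M => by simp [mul_smul] }
      (by simp)
      (fun M N => by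
        simp [Matrix.mul_apply, Fin.sum_univ_two, toeplitz_two_lower, toeplitz_two_diag, add_mul,
          mul_add, hN x x hx hx, add_smul, mul_smul]
        module)
    have hψ : ∀ M, ψ M = M.1 0 0 • 1 + M.1 0 1 • x := fun _ => rfl
    have hlψ : ∀ M, l (ψ M) = M.1 0 0 := fun M => by simp [hψ, hl, hx]
    refine identities_subset_of_injective ψ (fun M => ?_) ?_
    · rw [ht, hlψ]
      rfl
    · rw [injective_iff_map_eq_zero]
      intro M hM
      have h0 : M.1 0 0 = 0 := by rw [← hlψ, hM, map_zero]
      rw [hψ, h0, zero_smul, zero_add, smul_eq_zero, or_iff_left hx0] at hM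
      ext i j
      fin_cases i <;> fin_cases j <;> simp [h0, hM, toeplitz_two_lower, toeplitz_two_diag]
  · intro f hf a
    -- Each functional m gives a trace-preserving homomorphism A → C_2, because l is multiplicative
    -- and N² = 0. Together these homomorphisms separate the points of A.
    have key : ∀ m : Module.Dual F A, l (t.eval a f) = 0 ∧
        m (t.eval a f - l (t.eval a f) • 1) = 0 := by
      intro m
      let φ : A →ₐ[F] toeplitzMatrices F 2 := AlgHom.ofLinearMap
        { toFun := fun y => toeplitzTwo (l y) (m (y - l y • 1))
          map_add' := fun y z => by
            ext i j
            fin_cases i <;> fin_cases j <;> simp [toeplitzTwo, add_mul]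
            ring
          map_smul' := fun r y => by
            ext i j
            fin_cases i <;> fin_cases j <;> simp [toeplitzTwo]
            ring }
        (by
          ext i j
          fin_cases i <;> fin_cases j <;> simp [toeplitzTwo, hl])
        (fun y z => by
          ext i j
          fin_cases i <;> fin_cases j <;>
            simp [toeplitzTwo, hlmul]
          rw [hmul]
          simp
          ring)
      have hφ : ∀ y, φ y = toeplitzTwo (l y) (m (y - l y • 1)) := fun _ => rfl
      have h0 : φ (t.eval a f) = 0 := by
        rw [map_eval (s := toeplitzTrace 2 β) φ (fun y => ?_) a f, hf]
        rw [ht]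
        rfl
      rw [hφ] at h0
      have h1 := congrArg (fun M : toeplitzMatrices F 2 => M.1 0 0) h0
      have h2 := congrArg (fun M : toeplitzMatrices F 2 => M.1 0 1) h0
      exact ⟨by simpa [toeplitzTwo] using h1, by simpa [toeplitzTwo] using h2⟩
    have h0 := (key 0).1
    refine (Module.forall_dual_apply_eq_zero_iff F _).1 fun m => ?_
    have := (key m).2
    rwa [h0, zero_smul, sub_zero] at this

end DualNumbers

/-! ### Generic evaluation in D_2 and quadratic algebras -/

section Diagonal

variable {F : Type u} [Field F] {A : Type v} [Ring A] [Algebra F A]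

/-- Evaluation of trace polynomials at the pairs `(u i, v i)` in `R × R`, with trace
`(p, q) ↦ α * (p + q)`, followed by the first projection. -/
noncomputable def pairEval (α : F) {R : Type w} [CommRing R] [Algebra F R] (u v : ℕ → R) :
    FreeTraceAlgebra F →ₐ[F] R :=
  Algebra.TensorProduct.lift (FreeAlgebra.lift F u)
    (MvPolynomial.aeval fun c : TraceWord =>
      α • ((c.1.toMultiset.map u).prod + (c.1.toMultiset.map v).prod))
    (fun _ _ => Commute.all _ _)

@[simp]
theorem pairEval_ι (α : F) {R : Type w} [CommRing R] [Algebra F R] (u v : ℕ → R) (i : ℕ) :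
    pairEval α u v (FreeAlgebra.ι F i ⊗ₜ 1) = u i := by
  simp [pairEval]

@[simp]
theorem pairEval_X (α : F) {R : Type w} [CommRing R] [Algebra F R] (u v : ℕ → R)
    (c : TraceWord) :
    pairEval α u v (1 ⊗ₜ MvPolynomial.X c) =
      α • ((c.1.toMultiset.map u).prod + (c.1.toMultiset.map v).prod) := by
  simp [pairEval]

/-- Serves both to specialize indeterminates and to extend scalars. -/
theorem map_pairEval (α : F) {R : Type*} [CommRing R] [Algebra F R] {S : Type*} [CommRing S]
    [Algebra F S] (φ : R →ₐ[F] S) (u v : ℕ → R) (f : FreeTraceAlgebra F) :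
    φ (pairEval α u v f) = pairEval α (fun i => φ (u i)) (fun i => φ (v i)) f := by
  suffices H : φ.comp (pairEval α u v) = pairEval α (fun i => φ (u i)) (fun i => φ (v i)) from
    DFunLike.congr_fun H f
  apply freeTraceAlgebra_hom_ext
  · intro i
    simp
  · intro c
    simp [map_multiset_prod, Multiset.map_map]

/-- If the trace of `A` is `α` times the sum of two homomorphisms `φ`, `ψ` to a commutative
algebra, then `φ` turns evaluation in `A` into `pairEval`. -/
theorem map_eval_eq_pairEval (α : F) {R : Type*} [CommRing R] [Algebra F R]
    (t : AlgebraTrace F A) (φ ψ : A →ₐ[F] R)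
    (h : ∀ a, algebraMap F R (t.toFun a) = α • (φ a + ψ a)) (a : ℕ → A)
    (f : FreeTraceAlgebra F) :
    φ (t.eval a f) = pairEval α (fun i => φ (a i)) (fun i => ψ (a i)) f := by
  suffices H : φ.comp (t.eval a) = pairEval α (fun i => φ (a i)) (fun i => ψ (a i)) from
    DFunLike.congr_fun H f
  apply freeTraceAlgebra_hom_ext
  · intro i
    simp
  · rintro ⟨c, hc⟩
    rw [AlgHom.comp_apply, eval_X, pairEval_X, AlgHom.commutes]
    induction c using Quotient.inductionOn with
    | _ l =>
      change algebraMap F R (t.toFun (l.map a).prod) =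
        α • (((l : Multiset ℕ).map _).prod + ((l : Multiset ℕ).map _).prod)
      rw [h, map_list_prod, map_list_prod]
      simp [Function.comp_def]

/-- The `i`-th diagonal entry as a homomorphism. -/
def diagonalEntry (F : Type u) [Field F] {n : ℕ} (i : Fin n) : diagonalMatrices F n →ₐ[F] F :=
  AlgHom.ofLinearMap
    { toFun := fun M => M.1 i i
      map_add' := fun _ _ => rfl
      map_smul' := fun _ _ => rfl }
    (Matrix.one_apply_eq i)
    (fun M N => by
      change (M.1 * N.1) i i = M.1 i i * N.1 i i
      rw [Matrix.mul_apply]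
      refine Finset.sum_eq_single i (fun l _ hl => ?_) (by simp)
      rw [M.2 (Ne.symm hl), zero_mul])

theorem diagonalEntry_apply {n : ℕ} (i : Fin n) (M : diagonalMatrices F n) :
    diagonalEntry F i M = M.1 i i := rfl

theorem diagonal_ext {n : ℕ} {M N : diagonalMatrices F n}
    (h : ∀ i, diagonalEntry F i M = diagonalEntry F i N) : M = N := by
  ext i j
  by_cases hij : i = j
  · subst hij
    exact h i
  · rw [M.2 hij, N.2 hij]

theorem diagonalTrace_apply_two (α : F) (M : diagonalMatrices F 2) :
    (diagonalTrace ![α, α]).toFun M = α * (diagonalEntry F 0 M + diagonalEntry F 1 M) := by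
  simp [diagonalTrace, diagonalEntry_apply, Fin.sum_univ_two, mul_add]

/-- Both weights equal α, so exchanging u and v exchanges the diagonal entries; the first projection
therefore suffices. -/
theorem mem_identities_diagonalTrace {α : F} {f : FreeTraceAlgebra F}
    (h : ∀ u v : ℕ → F, pairEval α u v f = 0) : f ∈ (diagonalTrace ![α, α]).identities := by
  intro a
  apply diagonal_ext
  intro i
  rw [map_zero]
  fin_cases i
  · exact (map_eval_eq_pairEval α (diagonalTrace ![α, α]) (diagonalEntry F 0) (diagonalEntry F 1)
      (diagonalTrace_apply_two α) a f).trans (h _ _)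
  · exact (map_eval_eq_pairEval α (diagonalTrace ![α, α]) (diagonalEntry F 1) (diagonalEntry F 0)
      (fun M => (diagonalTrace_apply_two α M).trans (by rw [add_comm]; rfl)) a f).trans (h _ _)

/-- A commutative algebra `F[x]` with `x ^ 2 = d ≠ 0` and trace `2 α` times the coefficient `p` of
`p + q x` has no trace identities beyond those of the diagonal matrices. Here `w` is a square root
of `d` in an extension `K` of `F`. -/
theorem identities_subset_diagonalTrace [CharZero F] (t : AlgebraTrace F A) (α : F)
    (p q : A →ₗ[F] F) (x : A) (d : F) (hd : d ≠ 0)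
    {K : Type w} [Field K] [Algebra F K] (w : K) (hw : w * w = algebraMap F K d) (hx : x * x = d • 1)
    (hpq : ∀ a, a = p a • 1 + q a • x) (hp1 : p 1 = 1) (hpx : p x = 0) (hq1 : q 1 = 0)
    (hqx : q x = 1) (ht : ∀ a, t.toFun a = 2 * α * p a) :
    t.identities ⊆ (diagonalTrace ![α, α]).identities := by
  have hmul : ∀ a b, a * b = (p a * p b + q a * q b * d) • 1 + (p a * q b + q a * p b) • x := by
    intro a b
    conv_lhs => rw [hpq a, hpq b]
    simp only [add_mul, mul_add, smul_mul_smul_comm, one_mul, mul_one, hx, smul_smul, add_smul]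
    abel
  have hpmul : ∀ a b, p (a * b) = p a * p b + q a * q b * d := fun a b => by
    rw [hmul]; simp [hp1, hpx]
  have hqmul : ∀ a b, q (a * b) = p a * q b + q a * p b := fun a b => by
    rw [hmul]; simp [hq1, hqx]
  -- The homomorphism x ↦ w. The trace is α times the sum of those for w and -w.
  let π : (w : K) → w * w = algebraMap F K d → A →ₐ[F] K := fun w hw => AlgHom.ofLinearMap
    { toFun := fun a => algebraMap F K (p a) + algebraMap F K (q a) * w
      map_add' := fun a b => by simp; ring
      map_smul' := fun r a => by
        simp only [map_smul, smul_eq_mul, map_mul, RingHom.id_apply, Algebra.smul_def (A := K)]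
        ring }
    (by simp [hp1, hq1])
    (fun a b => by
      simp only [LinearMap.coe_mk, AddHom.coe_mk, hpmul, hqmul, map_add, map_mul]
      linear_combination -(algebraMap F K (q a) * algebraMap F K (q b)) * hw)
  have hπ : ∀ w hw a, π w hw a = algebraMap F K (p a) + algebraMap F K (q a) * w :=
    fun _ _ _ => rfl
  have hw0 : w ≠ 0 := by
    rintro rfl
    rw [zero_mul, eq_comm, map_eq_zero] at hw
    exact hd hw
  have : CharZero K := charZero_of_injective_algebraMap (algebraMap F K).injective
  have hw' : -w * -w = algebraMap F K d := by rw [neg_mul_neg, hw]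
  intro f hf
  -- Images of a generic element p + qx under x ↦ ±w: an F-point of the indeterminates is a
  -- substitution from A, a K-point is an arbitrary pair in K × K.
  let P : ℕ → MvPolynomial (ℕ ⊕ ℕ) K := fun i => MvPolynomial.X (Sum.inl i)
  let Q : ℕ → MvPolynomial (ℕ ⊕ ℕ) K := fun i => MvPolynomial.C w * MvPolynomial.X (Sum.inr i)
  have hev : ∀ z : ℕ ⊕ ℕ → K, MvPolynomial.eval z
      (pairEval α (fun i => P i + Q i) (fun i => P i - Q i) f) =
      pairEval α (fun i => z (Sum.inl i) + w * z (Sum.inr i))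
        (fun i => z (Sum.inl i) - w * z (Sum.inr i)) f := by
    intro z
    have := map_pairEval α ((MvPolynomial.aeval (R := K) z).restrictScalars F)
      (fun i => P i + Q i) (fun i => P i - Q i) f
    simpa [P, Q, MvPolynomial.aeval_eq_eval] using this
  have hg : pairEval α (fun i => P i + Q i) (fun i => P i - Q i) f = 0 := by
    -- A polynomial over K that vanishes at all points with coordinates in the infinite set F is
    -- zero.
    apply MvPolynomial.funext_set (fun _ => Set.range (algebraMap F K))
      (hs := fun _ => Set.infinite_range_of_injective (algebraMap F K).injective)
    · intro z hz
      choose y hy using fun i => hz i (Set.mem_univ i)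
      rw [hev, map_zero]
      have := map_eval_eq_pairEval α t (π w hw) (π (-w) hw')
        (fun a => by
          rw [hπ w hw, hπ (-w) hw', ht, Algebra.smul_def, map_mul, map_mul, map_ofNat]
          ring)
        (fun i => y (Sum.inl i) • 1 + y (Sum.inr i) • x) f
      rw [hf, map_zero] at this
      rw [this]
      simp only [hπ w hw, hπ (-w) hw', map_add, map_smul, hp1, hpx, hq1, hqx, hy, smul_eq_mul, mul_one, mul_zero,
        add_zero, zero_add]
      simp only [mul_neg, ← sub_eq_add_neg, mul_comm w]
  apply mem_identities_diagonalTrace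
  intro u v
  apply (algebraMap F K).injective
  have h1 := map_pairEval α (Algebra.ofId F K) u v f
  rw [map_zero]
  refine h1.trans ?_
  -- Solves p + wq = u, p - wq = v.
  have h2 := hev (Sum.elim (fun i => (algebraMap F K (u i) + algebraMap F K (v i)) / 2)
    (fun i => (algebraMap F K (u i) - algebraMap F K (v i)) / (2 * w)))
  rw [hg, map_zero] at h2
  rw [h2]
  simp only [Algebra.ofId_apply, Sum.elim_inl, Sum.elim_inr]
  congr 2 <;> funext i <;> field_simp <;> ring

/-! ### Two identities inherited from D_2 -/

theorem mul_comm_of_diagonal_identities {α : F} {t : AlgebraTrace F A}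
    (h : (diagonalTrace ![α, α]).identities ⊆ t.identities) (x y : A) : x * y = y * x := by
  have hf : (FreeAlgebra.ι F 0 ⊗ₜ 1 * FreeAlgebra.ι F 1 ⊗ₜ 1 -
      FreeAlgebra.ι F 1 ⊗ₜ 1 * FreeAlgebra.ι F 0 ⊗ₜ 1 : FreeTraceAlgebra F) ∈
      (diagonalTrace ![α, α]).identities := by
    apply mem_identities_diagonalTrace
    intro u v
    simp only [map_sub, map_mul, pairEval_ι]
    ring
  have := h hf (fun i => if i = 0 then x else y)
  simp only [map_sub, map_mul, eval_ι] at this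
  exact sub_eq_zero.1 this

/-- The formal trace of the nonempty word `i :: l`. -/
noncomputable def formalTrace (F : Type u) [Field F] (i : ℕ) (l : List ℕ) : FreeTraceAlgebra F :=
  1 ⊗ₜ MvPolynomial.X ⟨((i :: l : List ℕ) : Cycle ℕ), by simp⟩

theorem eval_formalTrace (t : AlgebraTrace F A) (a : ℕ → A) (i : ℕ) (l : List ℕ) :
    t.eval a (formalTrace F i l) = algebraMap F A (t.toFun (a i * (l.map a).prod)) := by
  rw [formalTrace, eval_X, cyclicWord_coe, List.map_cons, List.prod_cons]

/-- The linearized Cayley-Hamilton identity of `2 × 2` matrices. -/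
theorem cayleyHamilton_of_diagonal_identities {α : F} {t : AlgebraTrace F A}
    (h : (diagonalTrace ![α, α]).identities ⊆ t.identities) (x y : A) :
    (2 * α ^ 2) • (x * y) - (α * t.toFun x) • y - (α * t.toFun y) • x +
      (t.toFun x * t.toFun y - α * t.toFun (x * y)) • (1 : A) = 0 := by
  -- Polarized Cayley-Hamilton for the ordinary trace Tr/α, multiplied by α²; commutativity merges
  -- xy + yx into 2xy.
  have hf : ((2 * α ^ 2) • (FreeAlgebra.ι F 0 ⊗ₜ 1 * FreeAlgebra.ι F 1 ⊗ₜ 1) -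
      α • (formalTrace F 0 [] * FreeAlgebra.ι F 1 ⊗ₜ 1) -
      α • (formalTrace F 1 [] * FreeAlgebra.ι F 0 ⊗ₜ 1) +
      (formalTrace F 0 [] * formalTrace F 1 [] - α • formalTrace F 0 [1]) :
      FreeTraceAlgebra F) ∈ (diagonalTrace ![α, α]).identities := by
    apply mem_identities_diagonalTrace
    intro u v
    simp only [formalTrace, map_add, map_sub, map_smul, map_mul, pairEval_ι, pairEval_X,
      Cycle.coe_toMultiset, Multiset.map_coe, Multiset.prod_coe, List.map_cons, List.map_nil,
      List.prod_cons, List.prod_nil, smul_eq_mul]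
    ring
  have := h hf (fun i => if i = 0 then x else y)
  simp only [map_sub, map_add, map_smul, map_mul, eval_ι, eval_formalTrace] at this
  simpa [Algebra.algebraMap_eq_smul_one, smul_smul, sub_smul, mul_comm (t.toFun x)] using this

end Diagonal

end AlgebraTrace

/-! ### The classification -/

open AlgebraTrace in
theorem mainTheorem11 {F : Type u} [Field F] [CharZero F]
    {A : Type v} [Ring A] [Nontrivial A] [Algebra F A] [FiniteDimensional F A]
    (t : AlgebraTrace F A) (α : F) (hα : α ≠ 0)
    (hvar : AlgebraTrace.variety.{u, v, max u v} t ⊂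
      AlgebraTrace.variety.{u, u, max u v} (diagonalTrace ![α, α])) :
    (∃ β ∈ ({0, α, 2 * α} : Set F), t.Equivalent (toeplitzTrace 1 β)) ∨
      t.Equivalent (toeplitzTrace 2 (2 * α)) := by
  have hsub := identities_subset_of_variety_subset hvar.1
  have hnot := not_identities_subset_of_variety_ssubset hvar
  have hCH := cayleyHamilton_of_diagonal_identities hsub
  have hcomm := mul_comm_of_diagonal_identities hsub
  set s := t.toFun 1 with hs
  have hlin : ∀ x : A, (α * (2 * α - s)) • x = ((2 * α - s) * t.toFun x) • (1 : A) := by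
    intro x
    have := hCH x 1
    rw [mul_one, ← hs] at this
    rw [← sub_eq_zero, ← this]
    module
  by_cases h2 : s = 2 * α
  · let p : A →ₗ[F] F := (2 * α)⁻¹ • t.toFun
    have hp : ∀ a, t.toFun a = 2 * α * p a := fun a => by
      simp only [p, LinearMap.smul_apply, smul_eq_mul]
      field_simp
    have hp1 : p 1 = 1 := by
      have := hp 1
      rw [← hs, h2] at this
      exact (mul_left_cancel₀ (mul_ne_zero two_ne_zero hα) (by rw [mul_one]; exact this)).symm
    have hmul : ∀ x y : A, p x = 0 → p y = 0 → x * y = p (x * y) • 1 := by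
      intro x y hx hy
      have := hCH x y
      rw [hp x, hp y, hp (x * y), hx, hy] at this
      have h3 : (2 * α ^ 2) • (x * y - p (x * y) • 1) = 0 := by
        rw [← this]
        module
      rw [smul_eq_zero, or_iff_right (by simp [hα]), sub_eq_zero] at h3
      exact h3
    by_cases hN : ∀ x y : A, p x = 0 → p y = 0 → x * y = 0
    · by_cases hx : ∃ x : A, p x = 0 ∧ x ≠ 0
      · obtain ⟨x, hx, hx0⟩ := hx
        exact Or.inr (equivalent_toeplitzTrace_two t (2 * α) p hp1 hp hN x hx hx0)
      · push Not at hx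
        refine Or.inl ⟨2 * α, by simp, equivalent_toeplitzTrace_one t _ (fun a => ⟨p a, ?_⟩) h2⟩
        have := hx (a - p a • 1) (by simp [hp1])
        rwa [sub_eq_zero, ← Algebra.algebraMap_eq_smul_one] at this
    · exfalso
      -- If p killed all squares of elements of N, polarization would make every product in N
      -- vanish.
      obtain ⟨x, hx, hxx⟩ : ∃ x : A, p x = 0 ∧ p (x * x) ≠ 0 := by
        by_contra! hc
        refine hN fun x y hx hy => ?_
        have h0 := hc (x + y) (by rw [map_add, hx, hy, add_zero])
        rw [add_mul, mul_add, mul_add, map_add, map_add, map_add, hc x hx, hc y hy, hcomm y x,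
          zero_add, add_zero, ← two_mul, mul_eq_zero, or_iff_right two_ne_zero] at h0
        rw [hmul x y hx hy, h0, zero_smul]
      set d := p (x * x) with hd
      let q : A →ₗ[F] F := d⁻¹ • p.comp (LinearMap.mulRight F x)
      have hq : ∀ a, q a = d⁻¹ * p (a * x) := fun _ => rfl
      -- d need not be a square in F.
      obtain ⟨w, hw⟩ := IsAlgClosed.exists_eq_mul_self (algebraMap F (AlgebraicClosure F) d)
      refine hnot (identities_subset_diagonalTrace t α p q x d hxx w hw.symm (hmul x x hx hx)
        (fun a => ?_) hp1 hx (by rw [hq, one_mul, hx, mul_zero])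
        (by rw [hq, ← hd, inv_mul_cancel₀ hxx]) hp)
      set b := a - p a • (1 : A) with hb
      have hpb : p b = 0 := by simp [hb, hp1]
      have hpax : p (a * x) = p (b * x) := by simp [hb, sub_mul, hx]
      -- Comparing b(xx) = (bx)x, where both inner products are scalars, shows that b is a multiple
      -- of x.
      have h4 : d • b = p (b * x) • x := by
        have h5 : b * (x * x) = b * x * x := (mul_assoc _ _ _).symm
        rw [hmul x x hx hx, hmul b x hpb hx, ← hd] at h5
        simpa using h5
      have h6 : b = q a • x := by
        rw [hq, hpax, mul_smul, ← h4, smul_smul, inv_mul_cancel₀ hxx, one_smul]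
      rw [← h6, hb]
      abel
  · have hne : 2 * α - s ≠ 0 := sub_ne_zero.2 (Ne.symm h2)
    have hsc : ∀ x : A, x = algebraMap F A (α⁻¹ * t.toFun x) := by
      intro x
      have := congrArg (fun y => (α * (2 * α - s))⁻¹ • y) (hlin x)
      simp only [smul_smul] at this
      rw [inv_mul_cancel₀ (mul_ne_zero hα hne), one_smul] at this
      rw [Algebra.algebraMap_eq_smul_one]
      refine this.trans ?_
      congr 1
      rw [mul_inv, mul_assoc, inv_mul_cancel_left₀ hne]
    have hsα : s = α := by
      have := hsc 1
      rw [← map_one (algebraMap F A)] at this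
      have := (algebraMap F A).injective this
      rw [map_one, ← hs] at this
      field_simp at this
      exact this.symm
    exact Or.inl ⟨α, by simp, equivalent_toeplitzTrace_one t _ (fun a => ⟨_, hsc a⟩) hsα⟩
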